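/- **Theorem (Asymptotics of $C_n(\varphi,a)$).** Let $\varphi,a$ be real numbers with $$-\frac{\pi}{2}<\varphi<\frac{\pi}{2},\qquad \frac12-\frac{\varphi}{\pi}<a<\frac32-\frac{\varphi}{\pi}.$$ Call an integer $n\ge 2$ *admissible* if $\varphi+\frac{a\pi l}{n}\ne\pi\left(k+\frac12\right)$ for all $l=1,\dots,n-1$ and all $k\in\mathbb Z$; for such $n$ let $$C_n(\varphi,a)=\sum_{l=1}^{n-1}\sec\left(\varphi+\frac{a\pi l}{n}\right).$$ Let $B_{2r}$ be the Bernoulli numbers ($B_2=\frac16$, $B_4=-\frac1{30}$, ...), let $\mathscr G_{2r-1}(\alpha)=\frac{d^{2r-1}\sec\alpha}{d\alpha^{2r-1}}$, and put $$L_n=\frac{n}{a\pi}\ln\frac{\tan\left(\frac{3\pi}{4}-\frac{\pi a}{2}-\frac{\varphi}{2}\right)}{\tan\left(\frac{\varphi}{2}+\frac{\pi}{4}\right)},\qquad M_n=\frac na\cot\frac{n\left(\frac{\pi}{2}-\varphi\right)}{a}+L_n-\frac{\sec\varphi+\sec(\varphi+a\pi)}{2},$$ $$\beta_{N,n}=\sum_{r=1}^{N-1}\frac{(a\pi)^{2r-1}B_{2r}}{n^{2r-1}(2r)!}\Big\{\mathscr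 G_{2r-1}(\varphi)-\mathscr G_{2r-1}(\varphi+a\pi)\Big\}.$$ Then there is an $n_0$ such that for every $N=2,3,4,\ldots$ and all admissible $n>n_0$ $$C_n(\varphi,a)=M_n-\beta_{N,n}+O\left(n^{-2N+1}\right),$$ where the constant implied in $O$ depends only on $\varphi$, $a$ and $N$. Moreover, as $n\to\infty$: for every $N\ge2$ the Bernoulli sum $\beta_{N,n}$ tends to $0$; the terms in $M_n$ are the leading ones, that is, $C_n(\varphi,a)-M_n\to0$ along the admissible $n$; and the constant term $-\frac12\{\sec\varphi+\sec(\varphi+a\pi)\}$ is $o(L_n)$. -/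

import Mathlib

open Filter Topology Asymptotics

noncomputable section

/-- The secant, `sec x = 1 / cos x`. -/
def realSec (x : ℝ) : ℝ := 1 / Real.cos x

/-- The finite secant sum `C_n(φ, a) = ∑_{l=1}^{n-1} sec (φ + a π l / n)`. -/
def secantSum (n : ℕ) (φ a : ℝ) : ℝ :=
  ∑ l ∈ Finset.Ico 1 n, realSec (φ + a * Real.pi * l / n)

/-- The values of `n` for which `C_n(φ, a)` is defined: `n ≥ 2`, and no term is evaluated at a
pole of the secant. -/
def SecantSumDefined (n : ℕ) (φ a : ℝ) : Prop :=
  2 ≤ n ∧ ∀ l : ℕ, 1 ≤ l → l ≤ n - 1 → ∀ k : ℤ,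
    φ + a * Real.pi * l / n ≠ Real.pi * (k + 1 / 2)

/-- The cotangent term `(n / a) ctg (n (π/2 - φ) / a)`. -/
def cotangentTerm (n : ℕ) (φ a : ℝ) : ℝ :=
  (n : ℝ) / a * Real.cot (n * (Real.pi / 2 - φ) / a)

/-- The logarithmic term `(n / (a π)) ln (tg (3π/4 - πa/2 - φ/2) / tg (φ/2 + π/4))`. -/
def logTerm (n : ℕ) (φ a : ℝ) : ℝ :=
  (n : ℝ) / (a * Real.pi) *
    Real.log (Real.tan (3 * Real.pi / 4 - Real.pi * a / 2 - φ / 2) /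
      Real.tan (φ / 2 + Real.pi / 4))

/-- The constant term `-(sec φ + sec (φ + a π)) / 2`. -/
def constTerm (φ a : ℝ) : ℝ :=
  -((realSec φ + realSec (φ + a * Real.pi)) / 2)

/-- The derivative `G_{2r-1}(α) = d^{2r-1} sec α / dα^{2r-1}` (used for `r ≥ 1`). -/
def secDeriv (r : ℕ) (α : ℝ) : ℝ := iteratedDeriv (2 * r - 1) realSec α

/-- The finite Bernoulli sum
`∑_{r=1}^{N-1} (aπ)^{2r-1} B_{2r} / (n^{2r-1} (2r)!) (G_{2r-1}(φ) - G_{2r-1}(φ + aπ))`. -/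
def bernoulliSum (N n : ℕ) (φ a : ℝ) : ℝ :=
  ∑ r ∈ Finset.Ico 1 N,
    (a * Real.pi) ^ (2 * r - 1) * (bernoulli (2 * r) : ℝ) /
        ((n : ℝ) ^ (2 * r - 1) * (Nat.factorial (2 * r) : ℝ)) *
      (secDeriv r φ - secDeriv r (φ + a * Real.pi))

end

/-! The interval from `φ` to `φ + aπ` contains one pole of the secant, `π/2`, in its interior.
Removing `1/(π/2 - x)` leaves a function analytic on the closed interval, whose samples are summed
by Euler–Maclaurin (`trapezoid_analytic_bound`).

With `d = aπ/n` and `z = (π/2 - φ)/d`, the polar part is `1/d` times the sum of `1/(z - l)` over `0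
< l < n`. Euler's expansion of `π cot πz` completes this sum. The extra terms `1/(z + j)` and `1/(n
- z + j)` have denominators bounded below by `z` and `n - z`, so Euler–Maclaurin applies to them too
(`sum_recip_sub_bound`). The cotangent thus absorbs all sensitivity to nodes near the pole, and
since `z` and `n - z` are proportional to `n`, the error has the required order.

On recombining, the regular integral and the polar logarithm give `log tan` (`log_tan_half`), and
the Bernoulli corrections of both parts give the odd derivatives of the secant (`sum_secDeriv_eq`).
-/

/-! ### Euler–Maclaurin summation with an explicit remainder -/

section EulerMaclaurin

open Set MeasureTheory intervalIntegral

/-- The kernel of the remainder of order `2N` in the Euler–Maclaurin formula. -/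
noncomputable def eulerMaclaurinKernel (N : ℕ) (x : ℝ) : ℝ :=
  ((bernoulli (2 * N) : ℝ) - bernoulliFun (2 * N) x) / (Nat.factorial (2 * N) : ℝ)

/-- The sum of the Bernoulli corrections at an end point of the range of summation. -/
noncomputable def bernoulliCorrection (N : ℕ) (F : ℕ → ℝ → ℝ) (x : ℝ) : ℝ :=
  ∑ r ∈ Finset.Ico 1 N, (bernoulli (2 * r) : ℝ) / (Nat.factorial (2 * r) : ℝ) * F (2 * r - 1) x

theorem continuous_eulerMaclaurinKernel (N : ℕ) : Continuous (eulerMaclaurinKernel N) := by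
  unfold eulerMaclaurinKernel
  fun_prop

/-- The constant in the kernel makes it vanish at both ends of `[0, 1]`, so integrating by parts
against it leaves no boundary term. -/
theorem eulerMaclaurinKernel_zero (N : ℕ) : eulerMaclaurinKernel N 0 = 0 := by
  simp [eulerMaclaurinKernel, bernoulliFun_eval_zero]

theorem eulerMaclaurinKernel_one (N : ℕ) : eulerMaclaurinKernel N 1 = 0 := by
  rw [eulerMaclaurinKernel, bernoulliFun_endpoints_eq_of_ne_one (by omega), bernoulliFun_eval_zero]
  simp

theorem hasDerivAt_eulerMaclaurinKernel (N : ℕ) (x : ℝ) :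
    HasDerivAt (eulerMaclaurinKernel (N + 1))
      (-(bernoulliFun (2 * N + 1) x / (Nat.factorial (2 * N + 1) : ℝ))) x := by
  have h := ((hasDerivAt_bernoulliFun (2 * (N + 1)) x).const_sub
    (bernoulli (2 * (N + 1)) : ℝ)).div_const (Nat.factorial (2 * (N + 1)) : ℝ)
  refine h.congr_deriv ?_
  rw [show 2 * (N + 1) = 2 * N + 1 + 1 by ring, Nat.factorial_succ, Nat.add_sub_cancel]
  have h1 : ((2 * N + 1 + 1 : ℕ) : ℝ) ≠ 0 := by positivity
  have h2 : (Nat.factorial (2 * N + 1) : ℝ) ≠ 0 := by positivity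
  push_cast at h1 ⊢
  field_simp

/-- The Euler–Maclaurin formula on an interval of length one. -/
theorem eulerMaclaurin_unit (N : ℕ) (F : ℕ → ℝ → ℝ) (b : ℝ)
    (hF : ∀ k < 2 * (N + 1), ∀ x ∈ Icc b (b + 1), HasDerivAt (F k) (F (k + 1) x) x)
    (hc : ContinuousOn (F (2 * (N + 1))) (Icc b (b + 1))) :
    (F 0 b + F 0 (b + 1)) / 2 = (∫ x in b..(b + 1), F 0 x)
      + (bernoulliCorrection (N + 1) F (b + 1) - bernoulliCorrection (N + 1) F b)
      + ∫ x in b..(b + 1), F (2 * (N + 1)) x * eulerMaclaurinKernel (N + 1) (x - b) := by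
  have hu : uIcc b (b + 1) = Icc b (b + 1) := uIcc_of_le (by linarith)
  have hsub : ∀ x : ℝ, HasDerivAt (fun y => y - b) 1 x := fun x => (hasDerivAt_id x).sub_const b
  have hK : ∀ M x, HasDerivAt (fun y => eulerMaclaurinKernel (M + 1) (y - b))
      (-(bernoulliFun (2 * M + 1) (x - b) / (Nat.factorial (2 * M + 1) : ℝ))) x := by
    intro M x
    exact (hasDerivAt_eulerMaclaurinKernel M (x - b)).comp_sub_const x b
  have hcB : ∀ k, Continuous fun x => bernoulliFun k (x - b) := fun k =>
    (continuous_bernoulliFun k).comp (by fun_prop)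
  induction N with
  | zero =>
    have hc1 : ContinuousOn (F 1) (Icc b (b + 1)) := fun x hx =>
      (hF 1 (by norm_num) x hx).continuousAt.continuousWithinAt
    have i2 : IntervalIntegrable (F 2) volume b (b + 1) :=
      ContinuousOn.intervalIntegrable (by rw [hu]; exact hc)
    have i1 : IntervalIntegrable (F 1) volume b (b + 1) :=
      ContinuousOn.intervalIntegrable (by rw [hu]; exact hc1)
    have e1 := integral_mul_deriv_eq_deriv_mul (a := b) (b := b + 1) (u := F 1) (u' := F 2)
      (fun x hx => hF 1 (by norm_num) x (hu ▸ hx)) (fun x _ => hK 0 x) i2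
      (Continuous.intervalIntegrable (by have := hcB 1; fun_prop) _ _)
    -- The antiderivative of `1` is normalised to `y - b - 1/2`; its end values `∓1/2` are the
    -- trapezoidal weights.
    have e2 := integral_mul_deriv_eq_deriv_mul (a := b) (b := b + 1) (u := F 0) (u' := F 1)
      (fun x hx => hF 0 (by norm_num) x (hu ▸ hx))
      (fun x _ => (hsub x).sub_const (1 / 2)) i1 (by simp)
    simp only [add_sub_cancel_left, sub_self, eulerMaclaurinKernel_zero, eulerMaclaurinKernel_one,
      mul_neg, intervalIntegral.integral_neg] at e1 e2
    simp only [mul_zero, zero_add, Nat.factorial_one, Nat.cast_one, div_one, bernoulliFun_one,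
      mul_one] at e1 e2
    simp only [bernoulliCorrection, zero_add, Finset.Ico_self, Finset.sum_empty, mul_one]
    linarith
  | succ N ih =>
    have hc' : ∀ k < 2 * (N + 1 + 1), ContinuousOn (F k) (Icc b (b + 1)) := fun k hk x hx =>
      (hF k hk x hx).continuousAt.continuousWithinAt
    have ih := ih (fun k hk => hF k (by omega)) (hc' _ (by omega))
    have i0 : IntervalIntegrable (F (2 * (N + 1))) volume b (b + 1) :=
      ContinuousOn.intervalIntegrable (by rw [hu]; exact hc' _ (by omega))
    have i1 : IntervalIntegrable (F (2 * (N + 1) + 1)) volume b (b + 1) :=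
      ContinuousOn.intervalIntegrable (by rw [hu]; exact hc' _ (by omega))
    have i2 : IntervalIntegrable (F (2 * (N + 1) + 1 + 1)) volume b (b + 1) :=
      ContinuousOn.intervalIntegrable (by rw [hu]; exact hc)
    have e0 := integral_eq_sub_of_hasDerivAt (a := b) (b := b + 1)
      (fun x hx => hF (2 * (N + 1) - 1) (by omega) x (hu ▸ hx))
      (by rw [show 2 * (N + 1) - 1 + 1 = 2 * (N + 1) by omega]; exact i0)
    rw [show 2 * (N + 1) - 1 + 1 = 2 * (N + 1) by omega] at e0
    have hodd : (bernoulli (2 * (N + 1) + 1) : ℝ) = 0 := by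
      rw [bernoulli_eq_zero_of_odd ⟨N + 1, rfl⟩ (by omega)]; simp
    have hB : ∀ x, HasDerivAt
        (fun y => bernoulliFun (2 * (N + 1) + 1) (y - b) / (Nat.factorial (2 * (N + 1) + 1) : ℝ))
        (bernoulliFun (2 * (N + 1)) (x - b) / (Nat.factorial (2 * (N + 1)) : ℝ)) x := by
      intro x
      have h := ((hasDerivAt_bernoulliFun (2 * (N + 1) + 1) (x - b)).comp x (hsub x)).div_const
        (Nat.factorial (2 * (N + 1) + 1) : ℝ)
      refine h.congr_deriv ?_
      rw [Nat.factorial_succ, Nat.add_sub_cancel]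
      have h1 : ((2 * (N + 1) + 1 : ℕ) : ℝ) ≠ 0 := by positivity
      have h2 : (Nat.factorial (2 * (N + 1)) : ℝ) ≠ 0 := by positivity
      push_cast at h1 ⊢
      field_simp
    have e1 := integral_mul_deriv_eq_deriv_mul (a := b) (b := b + 1)
      (u := F (2 * (N + 1))) (u' := F (2 * (N + 1) + 1))
      (fun x hx => hF _ (by omega) x (hu ▸ hx)) (fun x _ => hB x) i1
      (Continuous.intervalIntegrable (by have := hcB (2 * (N + 1)); fun_prop) _ _)
    have e2 := integral_mul_deriv_eq_deriv_mul (a := b) (b := b + 1)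
      (u := F (2 * (N + 1) + 1)) (u' := F (2 * (N + 1) + 1 + 1))
      (fun x hx => hF _ (by omega) x (hu ▸ hx)) (fun x _ => hK (N + 1) x) i2
      (Continuous.intervalIntegrable (by have := hcB (2 * (N + 1) + 1); fun_prop) _ _)
    simp only [add_sub_cancel_left, sub_self, eulerMaclaurinKernel_zero, eulerMaclaurinKernel_one,
      bernoulliFun_endpoints_eq_of_ne_one (show 2 * (N + 1) + 1 ≠ 1 by omega),
      bernoulliFun_eval_zero, hodd, zero_div, mul_zero, zero_sub, mul_neg,
      intervalIntegral.integral_neg, neg_inj] at e1 e2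
    -- The constant part of the kernel yields, through `e0`, the new Bernoulli correction. The
    -- polynomial part is integrated by parts twice without boundary terms: the odd Bernoulli number
    -- is zero, and the next kernel vanishes at the ends.
    have e3 : (∫ x in b..(b + 1), F (2 * (N + 1)) x * eulerMaclaurinKernel (N + 1) (x - b)) =
        (bernoulli (2 * (N + 1)) : ℝ) / (Nat.factorial (2 * (N + 1)) : ℝ) *
          (∫ x in b..(b + 1), F (2 * (N + 1)) x) -
        ∫ x in b..(b + 1), F (2 * (N + 1)) x *
          (bernoulliFun (2 * (N + 1)) (x - b) / (Nat.factorial (2 * (N + 1)) : ℝ)) := by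
      rw [← intervalIntegral.integral_const_mul, ← intervalIntegral.integral_sub]
      · refine intervalIntegral.integral_congr fun x _ => ?_
        simp only [eulerMaclaurinKernel]
        ring
      · exact i0.const_mul _
      · refine i0.mul_continuousOn (Continuous.continuousOn ?_)
        have := hcB (2 * (N + 1))
        fun_prop
    have e4 : ∀ x, bernoulliCorrection (N + 1 + 1) F x = bernoulliCorrection (N + 1) F x +
        (bernoulli (2 * (N + 1)) : ℝ) / (Nat.factorial (2 * (N + 1)) : ℝ) *
          F (2 * (N + 1) - 1) x := by
      intro x
      rw [bernoulliCorrection, Finset.sum_Ico_succ_top (by omega), bernoulliCorrection]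
    rw [e4, e4, ih, e3, e0]
    have e5 : 2 * (N + 1 + 1) = 2 * (N + 1) + 1 + 1 := by ring
    rw [e5, e1, ← e2]
    ring

/-- The Euler–Maclaurin formula on `[0, m]` with a remainder bounded by the integral of the
derivative of order `2N`; the constant depends only on `N`. -/
theorem eulerMaclaurin_bound (N : ℕ) (hN : 1 ≤ N) : ∃ C : ℝ, 0 ≤ C ∧ ∀ (m : ℕ) (F : ℕ → ℝ → ℝ),
    (∀ k < 2 * N, ∀ x ∈ Icc (0 : ℝ) m, HasDerivAt (F k) (F (k + 1) x) x) →
    ContinuousOn (F (2 * N)) (Icc (0 : ℝ) m) →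
    |(∑ j ∈ Finset.range m, (F 0 j + F 0 (j + 1)) / 2) - (∫ x in (0 : ℝ)..m, F 0 x)
      - (bernoulliCorrection N F m - bernoulliCorrection N F 0)| ≤
      C * ∫ x in (0 : ℝ)..m, |F (2 * N) x| := by
  obtain ⟨N, rfl⟩ : ∃ M, N = M + 1 := ⟨N - 1, by omega⟩
  -- On every unit cell the kernel is a translate of the same function, so one bound serves all `m`
  -- and `F`.
  obtain ⟨C, hC⟩ := (isCompact_Icc (a := (0 : ℝ)) (b := 1)).exists_bound_of_continuousOn
    (continuous_eulerMaclaurinKernel (N + 1)).continuousOn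
  have hC0 : 0 ≤ C := (norm_nonneg _).trans (hC 0 (by simp))
  refine ⟨C, hC0, fun m F => ?_⟩
  induction m with
  | zero => intros; simp
  | succ m ih =>
    intro hF hc
    have hm : (m : ℝ) ≤ m + 1 := by linarith
    have hm0 : (0 : ℝ) ≤ m := by positivity
    push_cast at hF hc ⊢
    have s1 : Icc (0 : ℝ) m ⊆ Icc 0 (m + 1) := Icc_subset_Icc_right hm
    have s2 : Icc (m : ℝ) (m + 1) ⊆ Icc 0 (m + 1) := Icc_subset_Icc_left hm0
    have h1 := ih (fun k hk x hx => hF k hk x (s1 hx)) (hc.mono s1)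
    have h2 := eulerMaclaurin_unit N F m (fun k hk x hx => hF k hk x (s2 hx)) (hc.mono s2)
    have hc0 : ContinuousOn (F 0) (Icc (0 : ℝ) (m + 1)) := fun x hx =>
      (hF 0 (by omega) x hx).continuousAt.continuousWithinAt
    have ii : ∀ G : ℝ → ℝ, ContinuousOn G (Icc (0 : ℝ) (m + 1)) →
        IntervalIntegrable G volume 0 m ∧ IntervalIntegrable G volume m (m + 1) := fun G hG =>
      ⟨ContinuousOn.intervalIntegrable (by rw [uIcc_of_le hm0]; exact hG.mono s1),
        ContinuousOn.intervalIntegrable (by rw [uIcc_of_le hm]; exact hG.mono s2)⟩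
    have e0 := integral_add_adjacent_intervals (ii _ hc0).1 (ii _ hc0).2
    have e1 := integral_add_adjacent_intervals (ii _ hc.abs).1 (ii _ hc.abs).2
    have h3 : |∫ x in (m : ℝ)..(m + 1), F (2 * (N + 1)) x * eulerMaclaurinKernel (N + 1) (x - m)|
        ≤ C * ∫ x in (m : ℝ)..(m + 1), |F (2 * (N + 1)) x| := by
      rw [← intervalIntegral.integral_const_mul, ← Real.norm_eq_abs]
      refine intervalIntegral.norm_integral_le_of_norm_le hm (ae_of_all _ fun x hx => ?_)
        ((ii _ hc.abs).2.const_mul C)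
      rw [norm_mul, mul_comm, Real.norm_eq_abs (F _ _)]
      exact mul_le_mul_of_nonneg_right
        (hC _ ⟨by linarith [hx.1], by linarith [hx.2]⟩) (abs_nonneg _)
    rw [Finset.sum_range_succ, ← e0, ← e1, mul_add]
    refine le_trans (le_of_eq ?_) ((abs_add_le _ _).trans (add_le_add h1 h3))
    congr 1
    linarith

end EulerMaclaurin

/-! ### Sums of reciprocals and the cotangent -/

section ReciprocalSum

open Set MeasureTheory intervalIntegral

/-- The derivatives of `x ↦ 1 / (w + x)`. -/
noncomputable def recipDeriv (w : ℝ) (k : ℕ) (x : ℝ) : ℝ :=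
  (-1) ^ k * (Nat.factorial k : ℝ) / (w + x) ^ (k + 1)

theorem hasDerivAt_recipDeriv {w x : ℝ} (h : w + x ≠ 0) (k : ℕ) :
    HasDerivAt (recipDeriv w k) (recipDeriv w (k + 1) x) x := by
  have h1 : HasDerivAt (fun y : ℝ => (w + y) ^ (k + 1)) (((k + 1 : ℕ) : ℝ) * (w + x) ^ k * 1) x := by
    simpa using ((hasDerivAt_id x).const_add w).fun_pow (k + 1)
  have h2 := (hasDerivAt_const x ((-1) ^ k * (Nat.factorial k : ℝ))).fun_div h1 (pow_ne_zero _ h)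
  refine h2.congr_deriv ?_
  rw [recipDeriv, Nat.factorial_succ]
  push_cast
  field_simp
  ring

theorem recipDeriv_eq (w x : ℝ) (k : ℕ) : recipDeriv w k x = recipDeriv (w + x) k 0 := by
  simp [recipDeriv]

theorem bernoulliCorrection_recipDeriv (N : ℕ) (w x : ℝ) :
    bernoulliCorrection N (recipDeriv w) x = bernoulliCorrection N (recipDeriv (w + x)) 0 := by
  simp only [bernoulliCorrection]
  exact Finset.sum_congr rfl fun r _ => by rw [recipDeriv_eq]

/-- Trapezoidal sums of `1 / (w + x)` with step one. -/
theorem trapezoid_recip_bound (N : ℕ) (hN : 1 ≤ N) : ∃ C : ℝ, 0 ≤ C ∧ ∀ (m : ℕ) (w : ℝ), 0 < w →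
    |(∑ j ∈ Finset.range m, (1 / (w + j) + 1 / (w + (j + 1))) / 2) - Real.log ((w + m) / w)
      - (bernoulliCorrection N (recipDeriv (w + m)) 0 - bernoulliCorrection N (recipDeriv w) 0)| ≤
      C / w ^ (2 * N) := by
  obtain ⟨C, hC0, hC⟩ := eulerMaclaurin_bound N hN
  -- The derivative of order `2N` is positive, so its integral is a difference of end values, at
  -- most `(2N-1)!/w^(2N)` whatever `m` is. This uniformity permits `m → ∞` later.
  refine ⟨C * (Nat.factorial (2 * N - 1) : ℝ), by positivity, fun m w hw => ?_⟩
  have hm : (0 : ℝ) ≤ m := by positivity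
  have hu : uIcc (0 : ℝ) m = Icc 0 (m : ℝ) := uIcc_of_le hm
  have hne : ∀ x ∈ Icc (0 : ℝ) m, w + x ≠ 0 := fun x hx => by linarith [hx.1]
  have hd : ∀ k, ∀ x ∈ Icc (0 : ℝ) m, HasDerivAt (recipDeriv w k) (recipDeriv w (k + 1) x) x :=
    fun k x hx => hasDerivAt_recipDeriv (hne x hx) k
  have hcont : ∀ k, ContinuousOn (recipDeriv w k) (Icc (0 : ℝ) m) := fun k x hx =>
    (hd k x hx).continuousAt.continuousWithinAt
  have hint : ∀ k, IntervalIntegrable (recipDeriv w k) volume 0 m := fun k =>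
    ContinuousOn.intervalIntegrable (by rw [hu]; exact hcont k)
  have h := hC m (recipDeriv w) (fun k _ => hd k) (hcont _)
  have hlog : (∫ x in (0 : ℝ)..m, recipDeriv w 0 x) = Real.log ((w + m) / w) := by
    rw [integral_eq_sub_of_hasDerivAt (f := fun x => Real.log (w + x)) (fun x hx => ?_) (hint 0)]
    · rw [add_zero, Real.log_div (by linarith) hw.ne']
    · refine (((hasDerivAt_id x).const_add w).log (hne x (hu ▸ hx))).congr_deriv ?_
      simp [recipDeriv]
  have habs : (∫ x in (0 : ℝ)..m, |recipDeriv w (2 * N) x|) ≤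
      (Nat.factorial (2 * N - 1) : ℝ) / w ^ (2 * N) := by
    have e1 : (∫ x in (0 : ℝ)..m, |recipDeriv w (2 * N) x|) =
        ∫ x in (0 : ℝ)..m, recipDeriv w (2 * N) x := by
      refine intervalIntegral.integral_congr fun x hx => abs_of_nonneg ?_
      have : 0 < w + x := by linarith [(hu ▸ hx : x ∈ Icc (0 : ℝ) m).1]
      simp only [recipDeriv, pow_mul]
      norm_num
      positivity
    have e2 := integral_eq_sub_of_hasDerivAt (a := 0) (b := (m : ℝ))
      (fun x hx => hd (2 * N - 1) x (hu ▸ hx)) (hint _)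
    rw [show 2 * N - 1 + 1 = 2 * N by omega] at e2
    rw [e1, e2, recipDeriv, recipDeriv, show 2 * N - 1 + 1 = 2 * N by omega,
      Odd.neg_one_pow ⟨N - 1, by omega⟩]
    have : 0 ≤ (Nat.factorial (2 * N - 1) : ℝ) / (w + m) ^ (2 * N) := by positivity
    rw [add_zero, neg_one_mul, neg_div, neg_div]
    linarith
  rw [hlog, bernoulliCorrection_recipDeriv] at h
  have e : ∀ x : ℝ, recipDeriv w 0 x = 1 / (w + x) := fun x => by simp [recipDeriv]
  simp only [e] at h
  refine h.trans ?_
  rw [mul_div_assoc]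
  exact mul_le_mul_of_nonneg_left habs hC0

/-- Euler's partial fraction expansion of the cotangent at a real noninteger point. -/
theorem tendsto_real_cot_partial_fractions {z : ℝ} (hz : ∀ k : ℤ, z ≠ k) :
    Tendsto (fun n : ℕ => 1 / z + ∑ j ∈ Finset.range n, (1 / (z - (j + 1)) + 1 / (z + (j + 1))))
      atTop (𝓝 (Real.pi * Real.cot (Real.pi * z))) := by
  have hz' : (z : ℂ) ∈ Complex.integerComplement := by
    rintro ⟨k, hk⟩
    exact hz k (by exact_mod_cast hk.symm)
  have h := (tendsto_logDeriv_euler_cot_sub hz').const_add (1 / (z : ℂ))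
  rw [add_sub_cancel] at h
  have h2 := (Complex.continuous_re.tendsto _).comp h
  have e1 : (Real.pi * Complex.cot (Real.pi * z) : ℂ) =
      ((Real.pi * Real.cot (Real.pi * z) : ℝ) : ℂ) := by push_cast; rfl
  rw [e1, Complex.ofReal_re] at h2
  refine h2.congr fun n => ?_
  have e2 : (1 / (z : ℂ) + ∑ j ∈ Finset.range n, cotTerm z j) =
      ((1 / z + ∑ j ∈ Finset.range n, (1 / (z - (j + 1)) + 1 / (z + (j + 1))) : ℝ) : ℂ) := by
    push_cast
    rfl
  rw [Function.comp_apply, e2, Complex.ofReal_re]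

theorem trapezoid_eq_sum (f : ℕ → ℝ) (m : ℕ) :
    ∑ j ∈ Finset.range m, (f j + f (j + 1)) / 2 =
      (∑ j ∈ Finset.range (m + 1), f j) - f 0 / 2 - f m / 2 := by
  induction m with
  | zero => simp; ring
  | succ m ih => rw [Finset.sum_range_succ, ih, Finset.sum_range_succ _ (m + 1)]; ring

theorem tendsto_bernoulliCorrection_recipDeriv (N : ℕ) {u : ℕ → ℝ} (hu : Tendsto u atTop atTop) :
    Tendsto (fun m => bernoulliCorrection N (recipDeriv (u m)) 0) atTop (𝓝 0) := by
  have h : ∀ r ∈ Finset.Ico 1 N, Tendsto (fun m => (bernoulli (2 * r) : ℝ) /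
      (Nat.factorial (2 * r) : ℝ) * recipDeriv (u m) (2 * r - 1) 0) atTop
      (𝓝 ((bernoulli (2 * r) : ℝ) / (Nat.factorial (2 * r) : ℝ) * 0)) := by
    intro r _
    refine Tendsto.const_mul _ ?_
    simp only [recipDeriv, add_zero]
    exact tendsto_const_nhds.div_atTop ((tendsto_pow_atTop (by omega)).comp hu)
  simpa [bernoulliCorrection] using tendsto_finsetSum _ h

/-- A finite sum of `1 / (z - l)` over the integers strictly between `0` and `n`, where `z` lies
between the same bounds. -/
theorem sum_recip_sub_bound (N : ℕ) (hN : 1 ≤ N) : ∃ C : ℝ, 0 ≤ C ∧ ∀ (n : ℕ) (z : ℝ), 0 < z →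
    z < n → (∀ k : ℤ, z ≠ k) →
    |(∑ l ∈ Finset.Ico 1 n, 1 / (z - l)) - Real.pi * Real.cot (Real.pi * z) - Real.log (z / (n - z))
      + 1 / (2 * z) - 1 / (2 * (n - z))
      - (bernoulliCorrection N (recipDeriv z) 0 - bernoulliCorrection N (recipDeriv (n - z)) 0)| ≤
      C / z ^ (2 * N) + C / (n - z) ^ (2 * N) := by
  obtain ⟨C, hC0, hC⟩ := trapezoid_recip_bound N hN
  refine ⟨C, hC0, fun n z hz0 hzn hz => ?_⟩
  set y : ℝ := n - z with hy
  have hy0 : 0 < y := sub_pos.2 hzn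
  have hn : 1 ≤ n := by
    have : (0 : ℝ) < n := hz0.trans hzn
    exact_mod_cast this
  set T : ℕ → ℝ := fun m => ∑ j ∈ Finset.range (n + m), (1 / (z + j) + 1 / (z + (j + 1))) / 2 with hT
  set U : ℕ → ℝ := fun m => ∑ j ∈ Finset.range m, (1 / (y + j) + 1 / (y + (j + 1))) / 2 with hU
  set P : ℕ → ℝ := fun m =>
    1 / z + ∑ j ∈ Finset.range (n + m), (1 / (z - (j + 1)) + 1 / (z + (j + 1))) with hP
  set S : ℝ := ∑ l ∈ Finset.Ico 1 n, 1 / (z - l) with hS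
  -- In `P m` the terms `1/(z - l)` with `l < n` form `S`; those with `l = n + j`, `0 ≤ j ≤ m`,
  -- equal `-1/(y + j)` and are the nodes of `U m`.
  have key : ∀ m, S = P m - T m + U m - 1 / (2 * z) + 1 / (2 * y)
      - 1 / (2 * (z + (n + m))) + 1 / (2 * (y + m)) := by
    intro m
    have t1 := trapezoid_eq_sum (fun j : ℕ => 1 / (z + j)) (n + m)
    have t2 := trapezoid_eq_sum (fun j : ℕ => 1 / (y + j)) m
    have t3 : ∑ j ∈ Finset.range (n + m), 1 / (z - (j + 1)) =
        S - ∑ j ∈ Finset.range (m + 1), 1 / (y + j) := by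
      have e1 : ∑ j ∈ Finset.range (n + m), 1 / (z - ((j : ℝ) + 1)) =
          ∑ l ∈ Finset.Ico 1 (n + m + 1), 1 / (z - (l : ℝ)) := by
        rw [Finset.sum_Ico_eq_sum_range]
        refine Finset.sum_congr (by congr 1) fun j _ => ?_
        push_cast
        rw [add_comm (1 : ℝ)]
      have e2 : ∑ l ∈ Finset.Ico n (n + m + 1), 1 / (z - (l : ℝ)) =
          -∑ j ∈ Finset.range (m + 1), 1 / (y + j) := by
        rw [Finset.sum_Ico_eq_sum_range, ← Finset.sum_neg_distrib]
        refine Finset.sum_congr (by congr 1; omega) fun j _ => ?_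
        rw [← one_div_neg_eq_neg_one_div]
        push_cast
        congr 1
        rw [hy]; ring
      rw [e1, ← Finset.sum_Ico_consecutive _ hn (by omega : n ≤ n + m + 1), e2, hS]
      ring
    have t4 : ∑ j ∈ Finset.range (n + m + 1), 1 / (z + (j : ℝ)) =
        1 / z + ∑ j ∈ Finset.range (n + m), 1 / (z + ((j : ℝ) + 1)) := by
      rw [Finset.sum_range_succ']
      push_cast
      rw [add_zero, add_comm]
    have h1 : (1 / z) / 2 = 1 / (2 * z) := by rw [div_div, mul_comm]
    have h2 : (1 / y) / 2 = 1 / (2 * y) := by rw [div_div, mul_comm]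
    have h3 : (1 / (z + (n + m))) / 2 = 1 / (2 * (z + (n + m))) := by rw [div_div, mul_comm]
    have h4 : (1 / (y + m)) / 2 = 1 / (2 * (y + m)) := by rw [div_div, mul_comm]
    push_cast at t1 t2
    simp only [add_zero] at t1 t2
    simp only [hT, hU, hP]
    rw [t1, t2, Finset.sum_add_distrib, t3, t4]
    linarith
  have lz : Tendsto (fun m : ℕ => z + (n + (m : ℝ))) atTop atTop :=
    tendsto_atTop_add_const_left _ _
      (tendsto_atTop_add_const_left _ _ tendsto_natCast_atTop_atTop)
  have ly : Tendsto (fun m : ℕ => y + (m : ℝ)) atTop atTop :=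
    tendsto_atTop_add_const_left _ _ tendsto_natCast_atTop_atTop
  have lP : Tendsto P atTop (𝓝 (Real.pi * Real.cot (Real.pi * z))) := by
    refine (tendsto_real_cot_partial_fractions hz).comp
      (tendsto_atTop_mono (fun m => ?_) tendsto_id)
    simp
  have lr : ∀ u : ℕ → ℝ, Tendsto u atTop atTop → Tendsto (fun m => 1 / (2 * u m)) atTop (𝓝 0) :=
    fun u hu => tendsto_const_nhds.div_atTop (hu.const_mul_atTop (by norm_num))
  have llog : Tendsto (fun m : ℕ => Real.log ((z + (n + m)) / (y + m))) atTop (𝓝 0) := by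
    have h1 : Tendsto (fun m : ℕ => 1 + (z + n - y) / (y + (m : ℝ))) atTop (𝓝 (1 + 0)) :=
      (tendsto_const_nhds.div_atTop ly).const_add 1
    rw [add_zero] at h1
    have h2 := (Real.continuousAt_log one_ne_zero).tendsto.comp h1
    rw [Real.log_one] at h2
    refine h2.congr fun m => ?_
    have : y + (m : ℝ) ≠ 0 := by positivity
    rw [Function.comp_apply]
    congr 1
    field_simp
    ring
  -- All that depends on `m` sits in one absolute value tending to `0`; the diverging logarithms of
  -- the two tails cancel by `llog`.
  have hlim : Tendsto (fun m : ℕ => C / z ^ (2 * N) + C / y ^ (2 * N)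
      + |P m - Real.pi * Real.cot (Real.pi * z)
        - Real.log ((z + (n + m)) / (y + m))
        - (bernoulliCorrection N (recipDeriv (z + (n + m))) 0
          - bernoulliCorrection N (recipDeriv (y + m)) 0)
        - 1 / (2 * (z + (n + m))) + 1 / (2 * (y + m))|) atTop
      (𝓝 (C / z ^ (2 * N) + C / y ^ (2 * N))) := by
    have := ((((((lP.sub_const (Real.pi * Real.cot (Real.pi * z))).sub llog).sub
      ((tendsto_bernoulliCorrection_recipDeriv N lz).sub
        (tendsto_bernoulliCorrection_recipDeriv N ly))).sub (lr _ lz)).add (lr _ ly)).abs).const_add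
          (C / z ^ (2 * N) + C / y ^ (2 * N))
    simpa using this
  refine ge_of_tendsto' hlim fun m => ?_
  have b1 := hC (n + m) z hz0
  have b2 := hC m y hy0
  have hm0 : (0 : ℝ) ≤ m := by positivity
  have hn0 : (0 : ℝ) < n := hz0.trans hzn
  rw [Real.log_div (by push_cast; positivity) hz0.ne'] at b1
  rw [Real.log_div (by positivity) hy0.ne'] at b2
  rw [Real.log_div hz0.ne' hy0.ne', Real.log_div (by positivity) (by positivity)]
  push_cast at b1 b2
  rw [abs_le] at b1 b2
  have k := key m
  simp only [hT, hU] at k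
  set Q := P m - Real.pi * Real.cot (Real.pi * z)
        - (Real.log (z + (n + m)) - Real.log (y + m))
        - (bernoulliCorrection N (recipDeriv (z + (n + m))) 0
          - bernoulliCorrection N (recipDeriv (y + m)) 0)
        - 1 / (2 * (z + (n + m))) + 1 / (2 * (y + m)) with hQ
  have q1 := le_abs_self Q
  have q2 := neg_abs_le Q
  rw [abs_le]
  constructor <;> linarith [b1.1, b1.2, b2.1, b2.2]

end ReciprocalSum

/-! ### The secant with its pole removed -/

section SecantRegularPart

open Set MeasureTheory intervalIntegral

theorem AnalyticAt.dslope_of_analyticAt {f : ℝ → ℝ} {c x : ℝ} (hc : AnalyticAt ℝ f c)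
    (hx : AnalyticAt ℝ f x) : AnalyticAt ℝ (dslope f c) x := by
  rcases eq_or_ne x c with rfl | hne
  · obtain ⟨p, hp⟩ := hc
    exact ⟨_, hp.has_fpower_series_dslope_fslope⟩
  · refine AnalyticAt.congr ?_ (dslope_eventuallyEq_slope_of_ne f hne).symm
    have h1 : AnalyticAt ℝ (fun b => (b - c)⁻¹ * (f b - f c)) x :=
      ((analyticAt_id.sub analyticAt_const).fun_inv (sub_ne_zero.2 hne)).mul
        (hx.sub analyticAt_const)
    exact h1

theorem analyticAt_sinc (x : ℝ) : AnalyticAt ℝ Real.sinc x := by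
  rw [Real.sinc_eq_dslope]
  exact Real.analyticAt_sin.dslope_of_analyticAt Real.analyticAt_sin

theorem sinc_pos {x : ℝ} (h₁ : -Real.pi < x) (h₂ : x < Real.pi) : 0 < Real.sinc x := by
  rcases lt_trichotomy x 0 with h | rfl | h
  · rw [Real.sinc_of_ne_zero h.ne]
    exact div_pos_of_neg_of_neg (Real.sin_neg_of_neg_of_neg_pi_lt h h₁) h
  · simp
  · rw [Real.sinc_of_ne_zero h.ne']
    exact div_pos (Real.sin_pos_of_pos_of_lt_pi h h₂) h

/-- The regular part of the cosecant at `0`, that is `1 / sin u - 1 / u`. -/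
noncomputable def cscRegular : ℝ → ℝ := dslope (fun u => (Real.sinc u)⁻¹) 0

theorem cscRegular_of_ne_zero {u : ℝ} (hu : u ≠ 0) : cscRegular u = 1 / Real.sin u - 1 / u := by
  rw [cscRegular, dslope_of_ne _ hu, slope_def_field, Real.sinc_zero, Real.sinc_of_ne_zero hu]
  rcases eq_or_ne (Real.sin u) 0 with h | h
  -- At a nonzero zero of the sine both inverses default to `0`, and both sides equal `-1/u`.
  · simp [h, neg_div]
  · field_simp
    ring

theorem analyticAt_cscRegular {u : ℝ} (h₁ : -Real.pi < u) (h₂ : u < Real.pi) :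
    AnalyticAt ℝ cscRegular u :=
  AnalyticAt.dslope_of_analyticAt ((analyticAt_sinc 0).fun_inv (by simp))
    ((analyticAt_sinc u).fun_inv (sinc_pos h₁ h₂).ne')

/-- An antiderivative of `cscRegular` on `(-π, π)`. -/
noncomputable def cscRegularPrimitive (u : ℝ) : ℝ :=
  Real.log (Real.sinc (u / 2)) - Real.log (Real.cos (u / 2))

theorem continuousAt_cscRegularPrimitive {u : ℝ} (h₁ : -Real.pi < u) (h₂ : u < Real.pi) :
    ContinuousAt cscRegularPrimitive u := by
  have hs : Real.sinc (u / 2) ≠ 0 :=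
    (sinc_pos (by linarith [Real.pi_pos]) (by linarith [Real.pi_pos])).ne'
  have hc : Real.cos (u / 2) ≠ 0 :=
    (Real.cos_pos_of_mem_Ioo ⟨by linarith, by linarith⟩).ne'
  have c1 : ContinuousAt (fun u : ℝ => Real.sinc (u / 2)) u :=
    (Real.continuous_sinc.comp (by fun_prop : Continuous fun u : ℝ => u / 2)).continuousAt
  have c2 : ContinuousAt (fun u : ℝ => Real.cos (u / 2)) u := by fun_prop
  exact (c1.log hs).sub (c2.log hc)

theorem cscRegularPrimitive_of_ne_zero {u : ℝ} (h₁ : -Real.pi < u) (h₂ : u < Real.pi)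
    (hu : u ≠ 0) : cscRegularPrimitive u =
      Real.log (Real.sin (u / 2)) - Real.log (u / 2) - Real.log (Real.cos (u / 2)) := by
  have hu2 : u / 2 ≠ 0 := by simpa using hu
  have hs := (sinc_pos (x := u / 2) (by linarith [Real.pi_pos]) (by linarith [Real.pi_pos])).ne'
  rw [cscRegularPrimitive]
  rw [Real.sinc_of_ne_zero hu2] at hs ⊢
  -- Negative `u` is covered, since `Real.log` sees only absolute values.
  rw [Real.log_div (div_ne_zero_iff.1 hs).1 hu2]

theorem hasDerivAt_cscRegularPrimitive {u : ℝ} (h₁ : -Real.pi < u) (h₂ : u < Real.pi)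
    (hu : u ≠ 0) : HasDerivAt cscRegularPrimitive (cscRegular u) u := by
  have hs : Real.sin (u / 2) ≠ 0 := by
    have hs := (sinc_pos (x := u / 2) (by linarith [Real.pi_pos]) (by linarith [Real.pi_pos])).ne'
    rw [Real.sinc_of_ne_zero (by simpa using hu)] at hs
    exact (div_ne_zero_iff.1 hs).1
  have hc : Real.cos (u / 2) ≠ 0 :=
    (Real.cos_pos_of_mem_Ioo ⟨by linarith, by linarith⟩).ne'
  have d : HasDerivAt (fun u : ℝ => u / 2) (1 / 2) u := (hasDerivAt_id u).div_const 2
  have h := ((d.sin.log hs).sub (d.log (by simpa using hu))).sub (d.cos.log hc)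
  have hev : cscRegularPrimitive =ᶠ[𝓝 u] fun u =>
      Real.log (Real.sin (u / 2)) - Real.log (u / 2) - Real.log (Real.cos (u / 2)) := by
    filter_upwards [Ioo_mem_nhds h₁ h₂, isOpen_ne.mem_nhds hu] with v hv hv0
    exact cscRegularPrimitive_of_ne_zero hv.1 hv.2 hv0
  refine (h.congr_of_eventuallyEq hev).congr_deriv ?_
  have e : Real.sin u = 2 * Real.sin (u / 2) * Real.cos (u / 2) := by
    rw [← Real.sin_two_mul]; congr 1; ring
  rw [cscRegular_of_ne_zero hu, e]
  field_simp
  linear_combination u * Real.sin_sq_add_cos_sq (u / 2)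

/-- The secant without its polar part at `π / 2`. -/
noncomputable def secRegular (x : ℝ) : ℝ := cscRegular (Real.pi / 2 - x)

theorem analyticAt_secRegular {x : ℝ} (h₁ : -(Real.pi / 2) < x) (h₂ : x < 3 * Real.pi / 2) :
    AnalyticAt ℝ secRegular x :=
  AnalyticAt.fun_comp (g := cscRegular) (f := fun x => Real.pi / 2 - x)
    (analyticAt_cscRegular (by linarith) (by linarith)) (analyticAt_const.sub analyticAt_id)

theorem realSec_eq_secRegular_add {x : ℝ} (hx : x ≠ Real.pi / 2) :
    realSec x = secRegular x + 1 / (Real.pi / 2 - x) := by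
  rw [realSec, secRegular, cscRegular_of_ne_zero (sub_ne_zero.2 hx.symm), Real.sin_pi_div_two_sub]
  ring

/-- The primitive is continuous across the pole but differentiated only away from it; the
fundamental theorem tolerates a countable exceptional set. -/
theorem integral_secRegular {x y : ℝ} (hx : -(Real.pi / 2) < x) (hxy : x ≤ y)
    (hy : y < 3 * Real.pi / 2) :
    ∫ t in x..y, secRegular t =
      cscRegularPrimitive (Real.pi / 2 - x) - cscRegularPrimitive (Real.pi / 2 - y) := by
  have hu : uIcc x y = Icc x y := uIcc_of_le hxy
  have h := MeasureTheory.integral_eq_of_hasDerivAt_off_countable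
    (fun t => -cscRegularPrimitive (Real.pi / 2 - t)) secRegular (a := x) (b := y)
    (countable_singleton (Real.pi / 2)) ?_ ?_ ?_
  · rw [h]; ring
  · intro t ht
    rw [hu] at ht
    have c := continuousAt_cscRegularPrimitive (u := Real.pi / 2 - t)
      (by linarith [ht.2]) (by linarith [ht.1])
    exact (ContinuousAt.comp' (f := fun t => Real.pi / 2 - t) c
      (by fun_prop)).neg.continuousWithinAt
  · rintro t ⟨ht, hne⟩
    rw [min_eq_left hxy, max_eq_right hxy] at ht
    have d := hasDerivAt_cscRegularPrimitive (u := Real.pi / 2 - t)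
      (by linarith [ht.2]) (by linarith [ht.1]) (sub_ne_zero.2 (Ne.symm hne))
    simpa [secRegular] using (d.comp_const_sub (Real.pi / 2) t).fun_neg
  · refine ContinuousOn.intervalIntegrable fun t ht => ?_
    rw [hu] at ht
    exact (analyticAt_secRegular (by linarith [ht.1])
      (by linarith [ht.2])).continuousAt.continuousWithinAt

/-- The sign `(-1)^k` from differentiating an inverse cancels the one from the inner slope `-1`. -/
theorem iteratedDeriv_realSec {x : ℝ} (h₁ : -(Real.pi / 2) < x) (h₂ : x < 3 * Real.pi / 2)
    (hx : x ≠ Real.pi / 2) (k : ℕ) :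
    iteratedDeriv k realSec x =
      iteratedDeriv k secRegular x + (Nat.factorial k : ℝ) / (Real.pi / 2 - x) ^ (k + 1) := by
  have hev : realSec =ᶠ[𝓝 x] fun t => secRegular t + ((-1) * t - -(Real.pi / 2))⁻¹ := by
    filter_upwards [isOpen_ne.mem_nhds hx] with t ht
    rw [realSec_eq_secRegular_add ht, one_div]
    congr 2
    ring
  have hne : (-1) * x - -(Real.pi / 2) ≠ 0 := by
    intro h; apply hx; linarith
  have ha : AnalyticAt ℝ (fun t : ℝ => ((-1) * t - -(Real.pi / 2))⁻¹) x :=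
    ((analyticAt_const.mul analyticAt_id).sub analyticAt_const).fun_inv hne
  rw [hev.iteratedDeriv_eq k, iteratedDeriv_fun_add (analyticAt_secRegular h₁ h₂).contDiffAt
    ha.contDiffAt, iteratedDeriv_eq_iterate (f := fun t : ℝ => ((-1) * t - -(Real.pi / 2))⁻¹),
    iter_deriv_inv_linear_sub]
  have e : (-1) * x - -(Real.pi / 2) = Real.pi / 2 - x := by ring
  beta_reduce
  rw [e, show (-1 - k : ℤ) = -((k + 1 : ℕ) : ℤ) by push_cast; ring, zpow_neg, zpow_natCast,
    mul_right_comm _ _ ((-1 : ℝ) ^ k), ← mul_pow, neg_one_mul, neg_neg, one_pow, one_mul]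
  rfl

/-- The Euler–Maclaurin formula for the sampling of an analytic function at `n + 1` equidistant
points. -/
theorem trapezoid_analytic_bound (N : ℕ) (hN : 1 ≤ N) (f : ℝ → ℝ) {x y : ℝ} (hxy : x < y)
    (hf : ∀ t ∈ Icc x y, AnalyticAt ℝ f t) : ∃ C : ℝ, ∀ n : ℕ, 0 < n → ∀ d : ℝ, d = (y - x) / n →
    |(∑ j ∈ Finset.range n, (f (x + d * j) + f (x + d * (j + 1))) / 2) - (∫ t in x..y, f t) / d
      - (bernoulliCorrection N (fun k t => d ^ k * iteratedDeriv k f t) y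
        - bernoulliCorrection N (fun k t => d ^ k * iteratedDeriv k f t) x)| ≤
      C / (n : ℝ) ^ (2 * N - 1) := by
  obtain ⟨C, hC0, hC⟩ := eulerMaclaurin_bound N hN
  have han : ∀ k, ∀ t ∈ Icc x y, AnalyticAt ℝ (iteratedDeriv k f) t := fun k t ht => by
    rw [iteratedDeriv_eq_iterate]; exact (hf t ht).iterated_deriv k
  obtain ⟨B, hB⟩ := (isCompact_Icc (a := x) (b := y)).exists_bound_of_continuousOn
    (f := iteratedDeriv (2 * N) f) (fun t ht => (han _ t ht).continuousAt.continuousWithinAt)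
  -- Rescaling to step one brings out `d^(2N)`; integration over length `n` leaves `(y - x)^(2N) B /
  -- n^(2N-1)`.
  refine ⟨C * ((y - x) ^ (2 * N) * B), fun n hn d hd => ?_⟩
  have hn0 : (0 : ℝ) < n := by exact_mod_cast hn
  have hd0 : 0 < d := by rw [hd]; exact div_pos (by linarith) hn0
  have hdn : d * n = y - x := by rw [hd]; field_simp
  have hmem : ∀ s ∈ Icc (0 : ℝ) n, x + d * s ∈ Icc x y := fun s hs =>
    ⟨by have := mul_nonneg hd0.le hs.1; linarith,
      by have := mul_le_mul_of_nonneg_left hs.2 hd0.le; linarith⟩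
  have hlin : ∀ s : ℝ, HasDerivAt (fun s => x + d * s) d s := fun s => by
    simpa using ((hasDerivAt_id s).const_mul d).const_add x
  have hder : ∀ k, ∀ s ∈ Icc (0 : ℝ) n, HasDerivAt (fun s => d ^ k * iteratedDeriv k f (x + d * s))
      (d ^ (k + 1) * iteratedDeriv (k + 1) f (x + d * s)) s := by
    intro k s hs
    have h1 := (han k _ (hmem s hs)).differentiableAt.hasDerivAt
    rw [← iteratedDeriv_succ] at h1
    refine ((h1.comp s (hlin s)).const_mul (d ^ k)).congr_deriv ?_
    ring
  have h := hC n (fun k s => d ^ k * iteratedDeriv k f (x + d * s)) (fun k _ => hder k)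
    (fun s hs => (hder _ s hs).continuousAt.continuousWithinAt)
  have hint : (∫ s in (0 : ℝ)..n, f (x + d * s)) = (∫ t in x..y, f t) / d := by
    rw [intervalIntegral.integral_comp_add_mul f hd0.ne', mul_zero, add_zero, hdn,
      smul_eq_mul, add_sub_cancel, div_eq_inv_mul]
  have hbd : (∫ s in (0 : ℝ)..n, |d ^ (2 * N) * iteratedDeriv (2 * N) f (x + d * s)|) ≤
      (y - x) ^ (2 * N) * B / (n : ℝ) ^ (2 * N - 1) := by
    have h1 := intervalIntegral.norm_integral_le_of_norm_le_const (a := (0 : ℝ)) (b := n)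
      (f := fun s => |d ^ (2 * N) * iteratedDeriv (2 * N) f (x + d * s)|) (C := d ^ (2 * N) * B)
      (fun s hs => by
        rw [uIoc_of_le hn0.le] at hs
        rw [Real.norm_eq_abs, abs_abs, abs_mul, abs_of_pos (pow_pos hd0 _)]
        exact mul_le_mul_of_nonneg_left (hB _ (hmem s ⟨hs.1.le, hs.2⟩)) (pow_pos hd0 _).le)
    refine (le_abs_self _).trans (h1.trans (le_of_eq ?_))
    rw [sub_zero, abs_of_pos hn0, hd, div_pow]
    have e : (n : ℝ) ^ (2 * N) = (n : ℝ) ^ (2 * N - 1) * n := by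
      rw [← pow_succ]; congr 1; omega
    rw [e]
    field_simp
  have hend : ∀ s : ℝ, bernoulliCorrection N (fun k s => d ^ k * iteratedDeriv k f (x + d * s)) s =
      bernoulliCorrection N (fun k t => d ^ k * iteratedDeriv k f t) (x + d * s) := fun s => rfl
  simp only [hend, pow_zero, one_mul, iteratedDeriv_zero, hint, mul_zero, add_zero, hdn,
    add_sub_cancel] at h
  refine h.trans ?_
  rw [mul_div_assoc]
  exact mul_le_mul_of_nonneg_left hbd hC0

end SecantRegularPart

/-! ### Assembling the expansion of the secant sum -/

section SecantSumAsymptotics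

/-- The argument of the logarithm in `logTerm`, in terms of the distances of the end points to the
pole `π / 2`. -/
theorem tan_div_tan_eq (φ a : ℝ) :
    Real.tan (3 * Real.pi / 4 - Real.pi * a / 2 - φ / 2) / Real.tan (φ / 2 + Real.pi / 4) =
      Real.tan ((Real.pi / 2 - φ) / 2) / Real.tan ((φ + a * Real.pi - Real.pi / 2) / 2) := by
  have e1 : 3 * Real.pi / 4 - Real.pi * a / 2 - φ / 2 =
      Real.pi / 2 - (φ + a * Real.pi - Real.pi / 2) / 2 := by ring
  have e2 : φ / 2 + Real.pi / 4 = Real.pi / 2 - (Real.pi / 2 - φ) / 2 := by ring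
  rw [e1, e2, Real.tan_pi_div_two_sub, Real.tan_pi_div_two_sub, div_inv_eq_mul,
    inv_mul_eq_div]

theorem log_tan_half {u : ℝ} (h₁ : 0 < u) (h₂ : u < Real.pi) :
    Real.log (Real.tan (u / 2)) = cscRegularPrimitive u + Real.log (u / 2) := by
  have hs := Real.sin_pos_of_pos_of_lt_pi (x := u / 2) (by linarith) (by linarith)
  have hc := Real.cos_pos_of_mem_Ioo (x := u / 2) ⟨by linarith, by linarith⟩
  rw [Real.tan_eq_sin_div_cos, Real.log_div hs.ne' hc.ne',
    cscRegularPrimitive_of_ne_zero (by linarith) h₂ h₁.ne']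
  ring

theorem cscRegularPrimitive_neg (u : ℝ) : cscRegularPrimitive (-u) = cscRegularPrimitive u := by
  simp [cscRegularPrimitive, neg_div]

/-- Derivatives of odd order `2r - 1` have polar part with the even power `(π/2 - x)^(2r)`, so only
the squared distance to the pole matters and both end points are treated alike. -/
theorem sum_secDeriv_eq (N : ℕ) {x w d : ℝ} (h₁ : -(Real.pi / 2) < x) (h₂ : x < 3 * Real.pi / 2)
    (hd : d ≠ 0) (hw : w ≠ 0) (hx : (w * d) ^ 2 = (Real.pi / 2 - x) ^ 2) :
    ∑ r ∈ Finset.Ico 1 N, (bernoulli (2 * r) : ℝ) / (Nat.factorial (2 * r) : ℝ) *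
        (d ^ (2 * r - 1) * secDeriv r x) =
      bernoulliCorrection N (fun k t => d ^ k * iteratedDeriv k secRegular t) x -
        bernoulliCorrection N (recipDeriv w) 0 / d := by
  have hx' : x ≠ Real.pi / 2 := by
    rintro rfl
    rw [sub_self, zero_pow two_ne_zero] at hx
    exact pow_ne_zero 2 (mul_ne_zero hw hd) hx
  rw [bernoulliCorrection, bernoulliCorrection, Finset.sum_div, ← Finset.sum_sub_distrib]
  refine Finset.sum_congr rfl fun r hr => ?_
  obtain ⟨q, rfl⟩ : ∃ q, r = q + 1 := ⟨r - 1, by have := (Finset.mem_Ico.1 hr).1; omega⟩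
  have e : 2 * (q + 1) - 1 + 1 = 2 * (q + 1) := by omega
  rw [secDeriv, iteratedDeriv_realSec h₁ h₂ hx', recipDeriv, e,
    Odd.neg_one_pow ⟨q, by omega⟩, pow_mul (Real.pi / 2 - x), ← hx, ← pow_mul, mul_pow, add_zero,
    show d ^ (2 * (q + 1)) = d ^ (2 * (q + 1) - 1) * d by rw [← pow_succ, e]]
  field_simp
  ring

theorem bernoulliSum_eq (N n : ℕ) (φ a : ℝ) :
    bernoulliSum N n φ a =
      (∑ r ∈ Finset.Ico 1 N, (bernoulli (2 * r) : ℝ) / (Nat.factorial (2 * r) : ℝ) *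
        ((a * Real.pi / n) ^ (2 * r - 1) * secDeriv r φ)) -
      ∑ r ∈ Finset.Ico 1 N, (bernoulli (2 * r) : ℝ) / (Nat.factorial (2 * r) : ℝ) *
        ((a * Real.pi / n) ^ (2 * r - 1) * secDeriv r (φ + a * Real.pi)) := by
  rw [bernoulliSum, ← Finset.sum_sub_distrib]
  refine Finset.sum_congr rfl fun r _ => ?_
  rw [div_pow, mul_div_mul_comm]
  ring

/-- The asymptotic expansion of the secant sum with an error term of order `n ^ (1 - 2N)`. -/
theorem secantSum_bound (φ a : ℝ) (hφ₁ : -(Real.pi / 2) < φ) (hφ₂ : φ < Real.pi / 2)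
    (h₁ : Real.pi / 2 < φ + a * Real.pi) (h₂ : φ + a * Real.pi < 3 * Real.pi / 2)
    (N : ℕ) (hN : 1 ≤ N) : ∃ K : ℝ, ∀ n : ℕ, 0 < n → SecantSumDefined n φ a →
      |secantSum n φ a -
          (cotangentTerm n φ a + logTerm n φ a + constTerm φ a - bernoulliSum N n φ a)| ≤
        K / (n : ℝ) ^ (2 * N - 1) := by
  set y := φ + a * Real.pi with hy
  set u := Real.pi / 2 - φ with hu
  set v := y - Real.pi / 2 with hv
  have hu0 : 0 < u := by linarith
  have hv0 : 0 < v := by linarith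
  have hap : 0 < a * Real.pi := by linarith
  have ha : 0 < a := pos_of_mul_pos_left hap Real.pi_pos.le
  obtain ⟨C₁, hC₁⟩ := trapezoid_analytic_bound N hN secRegular (x := φ) (y := y) (by linarith)
    (fun t ht => analyticAt_secRegular (by linarith [ht.1]) (by linarith [ht.2]))
  obtain ⟨C₂, -, hC₂⟩ := sum_recip_sub_bound N hN
  -- As `z = u/d` and `n - z = v/d`, the polar error over `d` is `(C₂/u^(2N) + C₂/v^(2N)) d^(2N-1)`,
  -- with `d = aπ/n`.
  refine ⟨C₁ + (C₂ / u ^ (2 * N) + C₂ / v ^ (2 * N)) * (a * Real.pi) ^ (2 * N - 1),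
    fun n hn ⟨_, hdef⟩ => ?_⟩
  have hn0 : (0 : ℝ) < n := by exact_mod_cast hn
  set d := a * Real.pi / n with hd
  have hd0 : 0 < d := div_pos hap hn0
  have hdn : d * n = a * Real.pi := by rw [hd]; field_simp
  set z := u / d with hz
  have hzd : z * d = u := by rw [hz]; field_simp
  have hnz : n - z = v / d := by
    rw [eq_div_iff hd0.ne', sub_mul, hzd, mul_comm, hdn]; linarith
  have hz0 : 0 < z := div_pos hu0 hd0
  have hw0 : 0 < n - z := by rw [hnz]; exact div_pos hv0 hd0
  have hwd : (n - z) * d = v := by rw [hnz]; field_simp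
  have hpole : ∀ l ∈ Finset.Ico 1 n, φ + d * l ≠ Real.pi / 2 := by
    intro l hl h
    rw [Finset.mem_Ico] at hl
    refine hdef l hl.1 (by omega) 0 ?_
    rw [mul_div_right_comm, ← hd, h]
    push_cast
    ring
  -- Since `0 < z < n`, an integer `z` would place the node `l = z` on the pole.
  have hzint : ∀ k : ℤ, z ≠ k := by
    intro k hk
    have k0 : 0 < k := by rw [hk] at hz0; exact_mod_cast hz0
    lift k to ℕ using k0.le
    have kn : k < n := by
      have h := sub_pos.1 hw0
      rw [hk] at h
      exact_mod_cast h
    refine hpole k (Finset.mem_Ico.2 ⟨by exact_mod_cast k0, kn⟩) ?_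
    rw [Int.cast_natCast] at hk
    rw [← hk, mul_comm, hzd]
    linarith
  clear_value z d v u y
  have b₁ := hC₁ n hn d (by rw [hd, hy]; ring)
  have b₂ := hC₂ n z hz0 (sub_pos.1 hw0) hzint
  have b₃ : C₂ / z ^ (2 * N) + C₂ / (n - z) ^ (2 * N) =
      (C₂ / u ^ (2 * N) + C₂ / v ^ (2 * N)) * d ^ (2 * N - 1) * d := by
    rw [mul_assoc, ← pow_succ, show 2 * N - 1 + 1 = 2 * N by omega, hnz, hz, div_pow, div_pow]
    field_simp
  have b₄ := div_le_div_of_nonneg_right b₂ hd0.le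
  rw [b₃, mul_div_cancel_right₀ _ hd0.ne', hd, div_pow, ← hd, ← abs_of_pos hd0, ← abs_div] at b₄
  have hsum : secantSum n φ a = (∑ l ∈ Finset.Ico 1 n, secRegular (φ + d * l)) +
      (∑ l ∈ Finset.Ico 1 n, 1 / (z - l)) / d := by
    rw [secantSum, Finset.sum_div, ← Finset.sum_add_distrib]
    refine Finset.sum_congr rfl fun l hl => ?_
    rw [mul_div_right_comm, ← hd, realSec_eq_secRegular_add (hpole l hl), div_div, sub_mul, hzd]
    congr 2
    rw [hu]; ring
  have htrap := trapezoid_eq_sum (fun j : ℕ => secRegular (φ + d * j)) n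
  have hsplit : ∑ j ∈ Finset.range n, secRegular (φ + d * j) =
      secRegular φ + ∑ l ∈ Finset.Ico 1 n, secRegular (φ + d * l) := by
    rw [Finset.range_eq_Ico, Finset.sum_eq_sum_Ico_succ_bot hn]
    simp
  rw [Finset.sum_range_succ, hsplit] at htrap
  push_cast at htrap
  rw [mul_zero, add_zero, hdn, ← hy] at htrap
  have hsecφ : realSec φ = secRegular φ + 1 / u := by
    rw [realSec_eq_secRegular_add hφ₂.ne, hu]
  have hsecy : realSec y = secRegular y - 1 / v := by
    rw [realSec_eq_secRegular_add h₁.ne', show Real.pi / 2 - y = -v by rw [hv]; ring, div_neg,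
      sub_eq_add_neg]
  have hcot : cotangentTerm n φ a = Real.pi * Real.cot (Real.pi * z) / d := by
    have e : Real.pi * z = n * (Real.pi / 2 - φ) / a := by
      rw [hz, hd, hu]; field_simp
    rw [cotangentTerm, ← e, hd]
    field_simp
  have hlog : logTerm n φ a = ((∫ t in φ..y, secRegular t) + Real.log (z / (n - z))) / d := by
    have htu := Real.tan_pos_of_pos_of_lt_pi_div_two (x := u / 2) (by linarith) (by linarith)
    have htv := Real.tan_pos_of_pos_of_lt_pi_div_two (x := v / 2) (by linarith) (by linarith)
    have e : z / (n - z) = (u / 2) / (v / 2) := by rw [hnz, hz]; field_simp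
    rw [integral_secRegular hφ₁ (by linarith) h₂, ← hu, show Real.pi / 2 - y = -v by rw [hv]; ring,
      cscRegularPrimitive_neg, e, Real.log_div (by positivity) (by positivity), logTerm,
      tan_div_tan_eq, ← hu, ← hy, ← hv, Real.log_div htu.ne' htv.ne', log_tan_half hu0 (by linarith),
      log_tan_half hv0 (by linarith), hd]
    field_simp
    ring
  have hbern := bernoulliSum_eq N n φ a
  rw [← hd, ← hy, sum_secDeriv_eq N hφ₁ (by linarith) hd0.ne' hz0.ne' (by rw [hzd, hu]),
    sum_secDeriv_eq N (by linarith) h₂ hd0.ne' hw0.ne' (by rw [hwd, hv]; ring)] at hbern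
  have hu2 : 1 / (2 * z) / d = 1 / u / 2 := by
    rw [div_div, div_div, mul_assoc, hzd, mul_comm]
  have hv2 : 1 / (2 * (n - z)) / d = 1 / v / 2 := by
    rw [div_div, div_div, mul_assoc, hwd, mul_comm]
  rw [add_div C₁, mul_div_assoc]
  refine le_trans (le_of_eq ?_) ((abs_add_le _ _).trans (add_le_add b₁ b₄))
  congr 1
  rw [hsum, hcot, hlog, hbern, constTerm, ← hy, hsecφ, hsecy, htrap]
  simp only [sub_div, add_div] at hu2 hv2 ⊢
  rw [hu2, hv2]
  ring

theorem tendsto_bernoulliSum (N : ℕ) (φ a : ℝ) :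
    Tendsto (fun n : ℕ => bernoulliSum N n φ a) atTop (𝓝 0) := by
  have h : ∀ r ∈ Finset.Ico 1 N, Tendsto (fun n : ℕ =>
      (a * Real.pi) ^ (2 * r - 1) * (bernoulli (2 * r) : ℝ) /
        ((n : ℝ) ^ (2 * r - 1) * (Nat.factorial (2 * r) : ℝ)) *
      (secDeriv r φ - secDeriv r (φ + a * Real.pi))) atTop
      (𝓝 (0 * (secDeriv r φ - secDeriv r (φ + a * Real.pi)))) := by
    intro r hr
    have hr1 := (Finset.mem_Ico.1 hr).1
    refine Tendsto.mul_const _ (tendsto_const_nhds.div_atTop ?_)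
    exact ((tendsto_pow_atTop (by omega)).comp tendsto_natCast_atTop_atTop).atTop_mul_const
      (by positivity)
  simpa [bernoulliSum] using tendsto_finsetSum _ h

/-- Either the logarithm is nonzero and `logTerm` grows linearly in absolute value, or injectivity
of the tangent makes the interval symmetric about `π/2`, so that the two secants cancel and the
constant is `0`. -/
theorem constTerm_isLittleO_logTerm (φ a : ℝ) (hφ₁ : -(Real.pi / 2) < φ) (hφ₂ : φ < Real.pi / 2)
    (h₁ : Real.pi / 2 < φ + a * Real.pi) (h₂ : φ + a * Real.pi < 3 * Real.pi / 2) :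
    (fun _ : ℕ => constTerm φ a) =o[atTop] (fun n : ℕ => logTerm n φ a) := by
  have hap : 0 < a * Real.pi := by linarith
  have htu := Real.tan_pos_of_pos_of_lt_pi_div_two (x := (Real.pi / 2 - φ) / 2)
    (by linarith) (by linarith)
  have htv := Real.tan_pos_of_pos_of_lt_pi_div_two (x := (φ + a * Real.pi - Real.pi / 2) / 2)
    (by linarith) (by linarith)
  rw [isLittleO_const_left]
  by_cases hlog : Real.log (Real.tan ((Real.pi / 2 - φ) / 2) /
      Real.tan ((φ + a * Real.pi - Real.pi / 2) / 2)) = 0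
  · left
    have h := (div_eq_one_iff_eq htv.ne').1 (Real.eq_one_of_pos_of_log_eq_zero (by positivity) hlog)
    have h' := Real.injOn_tan ⟨by linarith, by linarith⟩ ⟨by linarith, by linarith⟩ h
    have e : φ + a * Real.pi = Real.pi - φ := by linarith
    rw [constTerm, realSec, realSec, e, Real.cos_pi_sub, div_neg]
    simp
  · right
    have h : Tendsto (fun n : ℕ => (n : ℝ) * |Real.log (Real.tan ((Real.pi / 2 - φ) / 2) /
        Real.tan ((φ + a * Real.pi - Real.pi / 2) / 2)) / (a * Real.pi)|) atTop atTop :=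
      tendsto_natCast_atTop_atTop.atTop_mul_const (abs_pos.2 (div_ne_zero hlog hap.ne'))
    refine h.congr fun n => ?_
    rw [Function.comp_apply, logTerm, tan_div_tan_eq, Real.norm_eq_abs, div_mul_comm, abs_mul,
      Nat.abs_cast, mul_comm]

end SecantSumAsymptotics

theorem mainTheorem11 (φ a : ℝ)
    (hφ₁ : -(Real.pi / 2) < φ) (hφ₂ : φ < Real.pi / 2)
    (ha₁ : 1 / 2 - φ / Real.pi < a) (ha₂ : a < 3 / 2 - φ / Real.pi) :
    (∃ n₀ : ℕ, ∀ N : ℕ, 2 ≤ N → ∃ K : ℝ, ∀ n : ℕ, n₀ < n → SecantSumDefined n φ a →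
      |secantSum n φ a -
          (cotangentTerm n φ a + logTerm n φ a + constTerm φ a - bernoulliSum N n φ a)| ≤
        K / (n : ℝ) ^ (2 * N - 1)) ∧
    (∀ N : ℕ, 2 ≤ N → Tendsto (fun n : ℕ => bernoulliSum N n φ a) atTop (𝓝 0)) ∧
    Tendsto
      (fun n : ℕ => secantSum n φ a - (cotangentTerm n φ a + logTerm n φ a + constTerm φ a))
      (atTop ⊓ 𝓟 {n : ℕ | SecantSumDefined n φ a}) (𝓝 0) ∧
    (fun _ : ℕ => constTerm φ a) =o[atTop] (fun n : ℕ => logTerm n φ a) := by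
  have h₁ : Real.pi / 2 < φ + a * Real.pi := by
    have h := mul_lt_mul_of_pos_right ha₁ Real.pi_pos
    rw [sub_mul, div_mul_cancel₀ _ Real.pi_ne_zero] at h
    linarith
  have h₂ : φ + a * Real.pi < 3 * Real.pi / 2 := by
    have h := mul_lt_mul_of_pos_right ha₂ Real.pi_pos
    rw [sub_mul, div_mul_cancel₀ _ Real.pi_ne_zero] at h
    linarith
  refine ⟨⟨0, fun N hN => secantSum_bound φ a hφ₁ hφ₂ h₁ h₂ N (by omega)⟩,
    fun N _ => tendsto_bernoulliSum N φ a, ?_,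
    constTerm_isLittleO_logTerm φ a hφ₁ hφ₂ h₁ h₂⟩
  -- The single order `N = 2` suffices: its error and its Bernoulli sum both tend to `0`.
  obtain ⟨K, hK⟩ := secantSum_bound φ a hφ₁ hφ₂ h₁ h₂ 2 (by norm_num)
  have hlim : Tendsto (fun n : ℕ => K / (n : ℝ) ^ (2 * 2 - 1) + |bernoulliSum 2 n φ a|) atTop
      (𝓝 0) := by
    have h := (tendsto_const_nhds (x := K)).div_atTop
      ((tendsto_pow_atTop (α := ℝ) (n := 2 * 2 - 1) (by norm_num)).comp
        (tendsto_natCast_atTop_atTop (R := ℝ)))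
    simpa using h.add (tendsto_bernoulliSum 2 φ a).abs
  refine squeeze_zero_norm' ?_ (hlim.mono_left inf_le_left)
  filter_upwards [mem_inf_of_left (Ioi_mem_atTop 0), mem_inf_of_right (mem_principal_self _)]
    with n hn hdef
  rw [Real.norm_eq_abs]
  refine le_trans (le_of_eq ?_) ((abs_sub _ _).trans (add_le_add_left (hK n hn hdef) _))
  congr 1
  ring
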